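/- Let $R$ be a commutative ring. (A) Let $\mathscr{A}$ be a strictly unital $A_\infty$-category over $R$ and let $\mathscr{A}^{\rm sf}\to\mathscr{A}$ be any semi-free resolution of $\mathscr A$. Then $\mathscr{A}^{\rm sf}$ has a nice unit: for every object $x$ of $\mathscr{A}^{\rm sf}$ there is an isomorphism of $R$-modules $R\cdot 1_x\cong R$, and the short exact sequence $$0\to R\cdot 1_x\to \mathrm{Hom}(x,x)\to \mathrm{Hom}(x,x)/R\cdot 1_x\to 0$$ splits in the category of graded $R$-modules. (B) The same holds if $\mathscr{A}$ is a DG category over $R$ and $\mathscr{A}^{\rm sf}\to\mathscr A$ is any semi-free resolution of $\mathscr A$ by a DG category. Conventions. The $A_\infty$-relations are $\sum_{m,d}(-1)^{\deg f_d+\dots+\deg f_1-d}\,m^{n-m+1}(f_n,\dots,m^m(f_{d+m},\dots,f_{d+1}),f_d,\dots,f_1)=0$; strict units are degree zero morphisms $1_x$ with $m^1(1_x)=0$, $m^2(f,1_x)=f$, $m^2(1_y,f)=(-1)^{\deg f}f$ for homogeneous $f:x\to y$, and $m^n(\dots,1_x,\dots)=0$ for $n>2$. DG categories satisfy $d(g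 f)=d(g) f+(-1)^{\deg g}g\,d(f)$. A semi-free resolution of $\mathscr A$ is a strict, strictly unital $A_\infty$-functor (in (B), a DG functor) $\mathscr{A}^{\rm sf}\to\mathscr A$ that is a quasi-equivalence and whose source is semi-free. A strictly unital $A_\infty$-category (DG category) $\mathscr C$ is semi-free if it is the union of an increasing sequence of $A_\infty$- (DG) subcategories $\mathscr C_0\subset\mathscr C_1\subset\cdots$ with the same objects as $\mathscr C$, such that $\mathscr C_0$ is the isomorphic image of the discrete category (with $\mathrm{Hom}(x,x)=R$ and $\mathrm{Hom}(x,y)=0$ for $x\ne y$) under $r\mapsto r\cdot 1_x$, and such that for every $n\geq 1$ there is a set $S_n$ of homogeneous morphisms of $\mathscr C$ with differential in $\mathscr C_{n-1}$ which freely generates $\mathscr C_n$ over $\mathscr C_{n-1}$. In (B) this means free generation as a graded $R$-linear category. In (A) it means that the canonical map $F(Q_n)/I_n\to\mathscr C_n$ is an isomorphism. Here $Q_n=\mathscr C_{n-1}\oplus R\cdot S_n$ is the graded quiver in which $S_n$ is a homogeneous basis of the second summand, $F(Q_n)$ is the free $A_\infty$-category on $Q_n$ (spanned by planar rooted trees with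 leaves labelled by composable morphisms of $Q_n$, with the $m^n$, $n\ge2$, given by grafting), and $I_n$ is the ideal generated by $m^k_{F(Q_n)}(b_k,\dots,b_1)-m^k_{\mathscr C_{n-1}}(b_k,\dots,b_1)$ for $k\ge 2$ and $b_i$ in $\mathscr C_{n-1}$, and by the relations saying that the units of $\mathscr C_{n-1}$ are strict units. -/

import Mathlib

universe u v w u' v'

namespace AInfty

/-! ### Composable sequences and graded quivers -/

/-- Possibly empty composable sequences `(fₙ, …, f₁)` of elements of `H`, leading from `x` to `y`;
`snoc p f` is the sequence `(p, f)`, with `f` on the right of `p`. -/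
inductive CSeq {V : Type u} (H : V → V → Type v) : V → V → Type (max u v)
  | nil (x : V) : CSeq H x x
  | snoc {x y z : V} (p : CSeq H y z) (f : H x y) : CSeq H x z

namespace CSeq

variable {V : Type u} {H : V → V → Type v}

/-- The one-term sequence. -/
def single {x y : V} (f : H x y) : CSeq H x y := snoc (nil y) f

/-- The number of terms. -/
def length : {x y : V} → CSeq H x y → ℕ
  | _, _, nil _ => 0
  | _, _, snoc p _ => p.length + 1

/-- Concatenation `(a, c)`. -/
def append {y z : V} (a : CSeq H y z) : {x : V} → CSeq H x y → CSeq H x z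
  | _, nil _ => a
  | _, snoc c f => snoc (append a c) f

/-- All ways of writing a sequence as a concatenation `(a, c)`. -/
def splits : {x y : V} → CSeq H x y → List (Σ z : V, CSeq H z y × CSeq H x z)
  | _, _, nil x => [⟨x, nil x, nil x⟩]
  | _, _, snoc (x := x) p f =>
      ⟨x, snoc p f, nil x⟩ :: p.splits.map (fun s => ⟨s.1, s.2.1, snoc s.2.2 f⟩)

/-- Image of a sequence under a map of graphs. -/
def map {W : Type u'} {K : W → W → Type v'} (F : V → W) (φ : ∀ {x y : V}, H x y → K (F x) (F y)) :
    {x y : V} → CSeq H x y → CSeq K (F x) (F y)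
  | _, _, nil x => nil (F x)
  | _, _, snoc p f => snoc (map F φ p) (φ f)

/-- Image of a sequence under a map of graphs which is the identity on vertices. -/
def mapId {K : V → V → Type v'} (φ : ∀ {x y : V}, H x y → K x y) :
    {x y : V} → CSeq H x y → CSeq K x y
  | _, _, nil x => nil x
  | _, _, snoc p f => snoc (mapId φ p) (φ f)

/-- The sequence `(a, f, c)`. -/
def ins {x x' y' y : V} (a : CSeq H y' y) (f : H x' y') (c : CSeq H x x') : CSeq H x y :=
  (a.snoc f).append c

end CSeq

/-- A (`ℤ`-graded, `R`-linear) graded quiver. -/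
structure GradedQuiver (R : Type w) [CommRing R] where
  Ob : Type u
  Hom : Ob → Ob → Type v
  [grp : ∀ x y, AddCommGroup (Hom x y)]
  [mod : ∀ x y, Module R (Hom x y)]
  /-- `gr x y k` is the module of morphisms of degree `k`. -/
  gr : ∀ x y, ℤ → Submodule R (Hom x y)
  internal : ∀ x y, DirectSum.IsInternal (gr x y)

attribute [instance] GradedQuiver.grp GradedQuiver.mod

/-- A homogeneous morphism, together with its degree. -/
structure GradedQuiver.Arrow {R : Type w} [CommRing R] (Q : GradedQuiver.{u, v} R)
    (x y : Q.Ob) where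
  deg : ℤ
  val : Q.Hom x y
  mem : val ∈ Q.gr x y deg

/-- For `p = (fₙ, …, f₁)` the integer `(deg fₙ - 1) + … + (deg f₁ - 1)`. -/
def CSeq.sdeg {R : Type w} [CommRing R] {Q : GradedQuiver.{u, v} R} :
    {x y : Q.Ob} → CSeq Q.Arrow x y → ℤ
  | _, _, .nil _ => 0
  | _, _, .snoc p f => p.sdeg + (f.deg - 1)

/-- `1 x ∈ Hom(x, x)` (of degree zero) is a nice unit: for every object `x` the module `R · 1 x` is
isomorphic to `R`, and `0 → R · 1 x → Hom(x, x) → Hom(x, x) / R · 1 x → 0` splits in the category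
of graded modules, i.e. the inclusion has a linear retraction that preserves degrees. -/
def GradedQuiver.IsNiceUnit {R : Type w} [CommRing R] (Q : GradedQuiver.{u, v} R)
    (one : ∀ x, Q.Hom x x) : Prop :=
  ∀ x : Q.Ob, Nonempty ((Submodule.span R {one x}) ≃ₗ[R] R) ∧
    ∃ ρ : Q.Hom x x →ₗ[R] (Submodule.span R {one x}),
      (∀ f : Submodule.span R {one x}, ρ f = f) ∧
      ∀ (k : ℤ) (f : Q.Hom x x), f ∈ Q.gr x x k → (ρ f : Q.Hom x x) ∈ Q.gr x x k

/-! ### A∞-categories -/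

/-- A non unital `A∞`-category. The operation `m` on a sequence `(fₙ, …, f₁)` of homogeneous
morphisms is `mⁿ(fₙ, …, f₁)`, of degree `deg fₙ + … + deg f₁ + 2 - n`; there is no `m⁰`, which is
encoded as `m⁰ = 0`. -/
structure AInfCat (R : Type w) [CommRing R] extends GradedQuiver.{u, v} R where
  m : ∀ {x y : Ob}, CSeq toGradedQuiver.Arrow x y → Hom x y
  m_mem : ∀ {x y : Ob} (p : CSeq toGradedQuiver.Arrow x y), m p ∈ gr x y (p.sdeg + 2)
  m_nil : ∀ x : Ob, m (CSeq.nil x) = 0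
  m_add : ∀ {x x' y' y : Ob} (a : CSeq toGradedQuiver.Arrow y' y)
    (c : CSeq toGradedQuiver.Arrow x x') (f g h : toGradedQuiver.Arrow x' y'),
    f.deg = h.deg → g.deg = h.deg → h.val = f.val + g.val →
      m (a.ins h c) = m (a.ins f c) + m (a.ins g c)
  m_smul : ∀ {x x' y' y : Ob} (a : CSeq toGradedQuiver.Arrow y' y)
    (c : CSeq toGradedQuiver.Arrow x x') (r : R) (f h : toGradedQuiver.Arrow x' y'),
    f.deg = h.deg → h.val = r • f.val →
      m (a.ins h c) = r • m (a.ins f c)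
  /-- The sum, over all ways of writing `(fₙ, …, f₁)` as `(a, b, c)`, of
  `(-1)^(deg c - length c) m(a, m(b), c)` vanishes (the terms with `b` empty are zero). -/
  rel : ∀ {x y : Ob} (p : CSeq toGradedQuiver.Arrow x y),
    (p.splits.map fun s => (s.2.1.splits.map fun t =>
      (s.2.2.sdeg).negOnePow •
        m (t.2.1.ins ⟨t.2.2.sdeg + 2, m t.2.2, m_mem t.2.2⟩ s.2.2)).sum).sum = 0

/-- `mⁿ(fₙ, …, f₁)` as a homogeneous morphism. -/
def AInfCat.mArrow {R : Type w} [CommRing R] (C : AInfCat.{u, v} R) {x y : C.Ob}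
    (p : CSeq C.Arrow x y) : C.Arrow x y :=
  ⟨p.sdeg + 2, C.m p, C.m_mem p⟩

/-- A strictly unital `A∞`-category. With the signs used in the `A∞`-relations above, the unit laws
for `m²` are `m²(f, 1) = f` and `m²(1, f) = (-1)^(deg f) f`. -/
structure SUAInfCat (R : Type w) [CommRing R] extends AInfCat.{u, v} R where
  one : ∀ x : Ob, Hom x x
  one_mem : ∀ x : Ob, one x ∈ gr x x 0
  m_one : ∀ x : Ob, m (CSeq.single ⟨0, one x, one_mem x⟩) = 0
  m_right_one : ∀ {x y : Ob} (f : toGradedQuiver.Arrow x y),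
    m (.snoc (.single f) ⟨0, one x, one_mem x⟩) = f.val
  m_left_one : ∀ {x y : Ob} (f : toGradedQuiver.Arrow x y),
    m (.snoc (.single ⟨0, one y, one_mem y⟩) f) = f.deg.negOnePow • f.val
  m_mid_one : ∀ {x y z : Ob} (a : CSeq toGradedQuiver.Arrow y z)
    (c : CSeq toGradedQuiver.Arrow x y), 2 ≤ a.length + c.length →
      m (a.ins ⟨0, one y, one_mem y⟩ c) = 0

namespace SUAInfCat

variable {R : Type w} [CommRing R]

/-- The unit as a homogeneous morphism. -/
def oneArrow (C : SUAInfCat.{u, v} R) (x : C.Ob) : C.Arrow x x := ⟨0, C.one x, C.one_mem x⟩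

/-- A strictly unital `A∞`-category has a nice unit. -/
def HasNiceUnit (C : SUAInfCat.{u, v} R) : Prop := C.toGradedQuiver.IsNiceUnit C.one

end SUAInfCat

/-! ### Free A∞-categories and their quotients -/

/-- Planar rooted trees with leaves labelled by `L`, all nodes having at least two inputs. These
are the symbols `(𝔱; fₙ, …, f₁)`. The tree `node p s t` is the grafting `pₖ ∨ … ∨ p₁ ∨ s ∨ t`,
where the sequence `p = (pₖ, …, p₁)` may be empty. -/
inductive PTree {V : Type u} (L : V → V → Type v) : V → V → Type (max u v)
  | leaf {x y : V} (l : L x y) : PTree L x y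
  | node {w x y z : V} (p : CSeq (PTree L) y z) (s : PTree L x y) (t : PTree L w x) : PTree L w z

/-- The grafting `tₙ ∨ … ∨ t₁` of at least two trees. -/
def PTree.graft {V : Type u} {L : V → V → Type v} :
    {x y : V} → (p : CSeq (PTree L) x y) → 2 ≤ p.length → PTree L x y
  | _, _, .snoc (.snoc p s) t, _ => .node p s t

mutual
/-- Evaluation of a labelled tree in an `A∞`-category (lifted to a larger universe, as required for
a mutual recursion): every node with `n` inputs becomes `mⁿ`. -/
def PTree.evalLift {R : Type w} [CommRing R] (C : AInfCat.{u, v} R) {L : C.Ob → C.Ob → Type v'}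
    (φ : ∀ {x y : C.Ob}, L x y → C.Arrow x y) :
    {x y : C.Ob} → PTree L x y → ULift.{u} (C.Arrow x y)
  | _, _, .leaf l => ⟨φ l⟩
  | _, _, .node p s t =>
      ⟨C.mArrow (.snoc (.snoc (PTree.evalSeq C φ p) (PTree.evalLift C φ s).down)
        (PTree.evalLift C φ t).down)⟩
/-- Evaluation of all the trees of a sequence. -/
def PTree.evalSeq {R : Type w} [CommRing R] (C : AInfCat.{u, v} R) {L : C.Ob → C.Ob → Type v'}
    (φ : ∀ {x y : C.Ob}, L x y → C.Arrow x y) :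
    {x y : C.Ob} → CSeq (PTree L) x y → CSeq C.Arrow x y
  | _, _, .nil x => .nil x
  | _, _, .snoc p t => .snoc (PTree.evalSeq C φ p) (PTree.evalLift C φ t).down
end

/-- Evaluation of a labelled tree in an `A∞`-category: every node with `n` inputs becomes `mⁿ`. -/
def PTree.eval {R : Type w} [CommRing R] (C : AInfCat.{u, v} R) {L : C.Ob → C.Ob → Type v'}
    (φ : ∀ {x y : C.Ob}, L x y → C.Arrow x y) {x y : C.Ob} (t : PTree L x y) : C.Arrow x y :=
  (PTree.evalLift C φ t).down

section Extension

variable {R : Type w} [CommRing R]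

/-- The homogeneous morphisms that lie in a given family of submodules. -/
def GradedQuiver.SubArrow (Q : GradedQuiver.{u, v} R) (N : ∀ x y, Submodule R (Q.Hom x y))
    (x y : Q.Ob) : Type v := {f : Q.Arrow x y // f.val ∈ N x y}

/-- Labels for the quiver `N + R·S`: homogeneous morphisms of `N`, and elements of `S`. -/
inductive GradedQuiver.Label (Q : GradedQuiver.{u, v} R) (N : ∀ x y, Submodule R (Q.Hom x y))
    (S : ∀ x y, Set (Q.Arrow x y)) (x y : Q.Ob) : Type v
  | old (b : Q.SubArrow N x y) : GradedQuiver.Label Q N S x y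
  | new (s : S x y) : GradedQuiver.Label Q N S x y

/-- The homogeneous morphism named by a label. -/
def GradedQuiver.Label.arrow {Q : GradedQuiver.{u, v} R} {N : ∀ x y, Submodule R (Q.Hom x y)}
    {S : ∀ x y, Set (Q.Arrow x y)} {x y : Q.Ob} : Q.Label N S x y → Q.Arrow x y
  | .old b => b.val
  | .new s => s.val

variable (C : SUAInfCat.{u, v} R) (N : ∀ x y, Submodule R (C.Hom x y))
  (S : ∀ x y, Set (C.Arrow x y))

/-- Trees labelled by `N + R·S`. -/
abbrev ExtTree : C.Ob → C.Ob → Type (max u v) := PTree (C.toGradedQuiver.Label N S)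

/-- The homogeneous morphism of `C` named by a labelled tree. -/
def ExtTree.eval {x y : C.Ob} (t : ExtTree C N S x y) : C.Arrow x y :=
  PTree.eval C.toAInfCat GradedQuiver.Label.arrow t

/-- A morphism of `N`, as a tree with one leaf. -/
def ExtTree.old {x y : C.Ob} (b : C.SubArrow N x y) : ExtTree C N S x y :=
  .leaf (.old b)

/-- Let `Q = N + R·S`, where `N` is a strictly unital `A∞`-subcategory and `S` is a set of free
generators. `ExtIdeal C N S` is the kernel of the projection from the module of formal linear
combinations of labelled trees onto the hom-module of `F(Q)/I`. It is generated, under linear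
combinations and the operations `mⁿ` with `n ≥ 2` (grafting), by
* the linearity of `Hom_Q` in a label (together with grafting this is multilinearity in all labels,
  so that the quotient by these relations is `F(Q)`);
* `mⁿ_{F(Q)}(bₙ, …, b₁) - mⁿ_N(bₙ, …, b₁)` for `bᵢ` in `N` and `n ≥ 2`;
* the relations that make the units of `N` strict units. -/
inductive ExtIdeal : {x y : C.Ob} → (ExtTree C N S x y →₀ R) → Prop
  | zero {x y : C.Ob} : ExtIdeal (0 : ExtTree C N S x y →₀ R)
  | add {x y : C.Ob} (a b : ExtTree C N S x y →₀ R) :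
      ExtIdeal a → ExtIdeal b → ExtIdeal (a + b)
  | smul {x y : C.Ob} (r : R) (a : ExtTree C N S x y →₀ R) : ExtIdeal a → ExtIdeal (r • a)
  | graft {x x' y' y : C.Ob} (a : CSeq (ExtTree C N S) y' y) (c : CSeq (ExtTree C N S) x x')
      (h : ∀ t : ExtTree C N S x' y', 2 ≤ (a.ins t c).length)
      (e : ExtTree C N S x' y' →₀ R) :
      ExtIdeal e → ExtIdeal (e.mapDomain fun t => PTree.graft (a.ins t c) (h t))
  | label_add {x y : C.Ob} (f g h : C.SubArrow N x y) :
      f.val.deg = h.val.deg → g.val.deg = h.val.deg → h.val.val = f.val.val + g.val.val →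
      ExtIdeal (Finsupp.single (ExtTree.old C N S h) 1 -
        (Finsupp.single (ExtTree.old C N S f) 1 + Finsupp.single (ExtTree.old C N S g) 1))
  | label_smul {x y : C.Ob} (r : R) (f h : C.SubArrow N x y) :
      f.val.deg = h.val.deg → h.val.val = r • f.val.val →
      ExtIdeal (Finsupp.single (ExtTree.old C N S h) 1 -
        r • Finsupp.single (ExtTree.old C N S f) 1)
  | op {x y : C.Ob} (p : CSeq (C.SubArrow N) x y)
      (hp : 2 ≤ (p.mapId (fun b => ExtTree.old C N S b)).length) (b : C.SubArrow N x y) :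
      b.val = C.mArrow (p.mapId fun f => f.val) →
      ExtIdeal (Finsupp.single (PTree.graft (p.mapId fun b => ExtTree.old C N S b) hp) 1 -
        Finsupp.single (ExtTree.old C N S b) 1)
  | right_one {x y : C.Ob} (t : ExtTree C N S x y) (e : C.SubArrow N x x) :
      e.val = C.oneArrow x →
      ExtIdeal (Finsupp.single (PTree.node (.nil y) t (ExtTree.old C N S e)) 1 -
        Finsupp.single t 1)
  | left_one {x y : C.Ob} (t : ExtTree C N S x y) (e : C.SubArrow N y y) :
      e.val = C.oneArrow y →
      ExtIdeal (Finsupp.single (PTree.node (.nil y) (ExtTree.old C N S e) t) 1 -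
        (ExtTree.eval C N S t).deg.negOnePow • Finsupp.single t 1)
  | mid_one {x y z : C.Ob} (a : CSeq (ExtTree C N S) y z) (c : CSeq (ExtTree C N S) x y)
      (e : C.SubArrow N y y) (h : 3 ≤ (a.ins (ExtTree.old C N S e) c).length) :
      e.val = C.oneArrow y →
      ExtIdeal (Finsupp.single
        (PTree.graft (a.ins (ExtTree.old C N S e) c) (le_trans (by norm_num) h)) 1)

/-- `N'` is freely generated, as a strictly unital graded `A∞`-category, over `N` by the set `S`
of homogeneous morphisms: evaluation of trees induces an isomorphism `F(N + R·S)/I ≅ N'`. (The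
`A∞`-relations determine `m¹` on both sides by its values on `N` and `S`, so that the isomorphism is
one of `A∞`-categories as soon as it respects the operations `mⁿ` with `n ≥ 2`.) -/
def IsFreeExtension (N' : ∀ x y, Submodule R (C.Hom x y)) : Prop :=
  ∀ x y : C.Ob,
    LinearMap.range (Finsupp.linearCombination R
      fun t : ExtTree C N S x y => (ExtTree.eval C N S t).val) = N' x y ∧
    ∀ e : ExtTree C N S x y →₀ R,
      Finsupp.linearCombination R (fun t => (ExtTree.eval C N S t).val) e = 0 ↔ ExtIdeal C N S e

end Extension

/-! ### Semi-free A∞-categories and resolutions -/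

section SemiFree

variable {R : Type w} [CommRing R]

/-- A family of submodules of the hom-modules is graded. -/
def GradedQuiver.IsGradedSub (Q : GradedQuiver.{u, v} R)
    (N : ∀ x y, Submodule R (Q.Hom x y)) : Prop :=
  ∀ x y, N x y ≤ ⨆ k : ℤ, N x y ⊓ Q.gr x y k

/-- A filtration exhibiting a strictly unital `A∞`-category as semi-free (over its discrete
category): an increasing exhaustive sequence of `A∞`-subcategories `N 0 ⊆ N 1 ⊆ …` with all objects,
such that `N 0` is the isomorphic image of the discrete category, whose hom-modules are `R` on the
diagonal and zero off it, under the functor `r ↦ r · 1` (fields `zero_diag`, `zero_inj`, `zero_off`),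
and `N (n + 1)` is freely generated over `N n` by a set `S n` of homogeneous morphisms whose differential
lies in `N n`. -/
structure SemiFreeFiltration (C : SUAInfCat.{u, v} R) where
  N : ℕ → ∀ x y, Submodule R (C.Hom x y)
  graded : ∀ n, C.IsGradedSub (N n)
  closed : ∀ (n : ℕ) {x y : C.Ob} (p : CSeq (C.SubArrow (N n)) x y),
    C.m (p.mapId fun f => f.val) ∈ N n x y
  mono : ∀ (n : ℕ) (x y : C.Ob), N n x y ≤ N (n + 1) x y
  exhaustive : ∀ (x y : C.Ob) (f : C.Hom x y), ∃ n, f ∈ N n x y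
  zero_diag : ∀ x : C.Ob, N 0 x x = Submodule.span R {C.one x}
  zero_inj : ∀ x : C.Ob, Function.Injective fun r : R => r • C.one x
  zero_off : ∀ x y : C.Ob, x ≠ y → N 0 x y = ⊥
  S : ℕ → ∀ x y, Set (C.Arrow x y)
  d_mem : ∀ (n : ℕ) (x y : C.Ob), ∀ s ∈ S n x y, C.m (.single s) ∈ N n x y
  free : ∀ n, IsFreeExtension C (N n) (S n) (N (n + 1))

/-- Semi-free strictly unital `A∞`-categories. -/
def SUAInfCat.IsSemiFree (C : SUAInfCat.{u, v} R) : Prop := Nonempty (SemiFreeFiltration C)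

/-- A strict, strictly unital `A∞`-functor. -/
structure StrictFunctor (A : SUAInfCat.{u, v} R) (B : SUAInfCat.{u', v'} R) where
  obj : A.Ob → B.Ob
  map : ∀ {x y : A.Ob}, A.Hom x y →ₗ[R] B.Hom (obj x) (obj y)
  map_mem : ∀ {x y : A.Ob} (k : ℤ) (f : A.Hom x y), f ∈ A.gr x y k →
    map f ∈ B.gr (obj x) (obj y) k
  map_m : ∀ {x y : A.Ob} (p : CSeq A.Arrow x y),
    map (A.m p) = B.m (p.map obj fun f => ⟨f.deg, map f.val, map_mem f.deg f.val f.mem⟩)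
  map_one : ∀ x : A.Ob, map (A.one x) = B.one (obj x)

/-- A homogeneous morphism of degree `k` is the differential of one of degree `k - 1`. -/
def AInfCat.IsExact (A : AInfCat.{u, v} R) {x y : A.Ob} (k : ℤ) (f : A.Hom x y) : Prop :=
  ∃ h : A.Arrow x y, h.deg = k - 1 ∧ A.m (.single h) = f

/-- Objects that become isomorphic in the category `H⁰`. -/
def SUAInfCat.H0Iso (B : SUAInfCat.{u, v} R) (x y : B.Ob) : Prop :=
  ∃ (f : B.Arrow x y) (g : B.Arrow y x), f.deg = 0 ∧ g.deg = 0 ∧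
    B.m (.single f) = 0 ∧ B.m (.single g) = 0 ∧
    B.IsExact 0 (B.m (.snoc (.single g) f) - B.one x) ∧
    B.IsExact 0 (B.m (.snoc (.single f) g) - B.one y)

/-- A quasi-equivalence: bijective on the cohomology of the hom-complexes (first injectivity, then
surjectivity) and essentially surjective on `H⁰`. -/
def StrictFunctor.IsQuasiEquivalence {A : SUAInfCat.{u, v} R} {B : SUAInfCat.{u', v'} R}
    (F : StrictFunctor A B) : Prop :=
  (∀ (x y : A.Ob) (f : A.Arrow x y), A.m (.single f) = 0 →
    B.IsExact f.deg (F.map f.val) → A.IsExact f.deg f.val) ∧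
  (∀ (x y : A.Ob) (g : B.Arrow (F.obj x) (F.obj y)), B.m (.single g) = 0 →
    ∃ f : A.Arrow x y, f.deg = g.deg ∧ A.m (.single f) = 0 ∧
      B.IsExact g.deg (F.map f.val - g.val)) ∧
  ∀ z : B.Ob, ∃ x : A.Ob, B.H0Iso (F.obj x) z

/-- A semi-free resolution of a strictly unital `A∞`-category. -/
structure SemiFreeResolution (A : SUAInfCat.{u, v} R) where
  cat : SUAInfCat.{u', v'} R
  semiFree : cat.IsSemiFree
  functor : StrictFunctor cat A
  quasiEquivalence : functor.IsQuasiEquivalence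

end SemiFree

/-! ### DG categories -/

/-- A DG category over `R`. -/
structure DGCat (R : Type w) [CommRing R] extends GradedQuiver.{u, v} R where
  d : ∀ {x y : Ob}, Hom x y →ₗ[R] Hom x y
  d_mem : ∀ {x y : Ob} (k : ℤ) (f : Hom x y), f ∈ gr x y k → d f ∈ gr x y (k + 1)
  d_d : ∀ {x y : Ob} (f : Hom x y), d (d f) = 0
  /-- `comp g f` is the composition `g · f`. -/
  comp : ∀ {x y z : Ob}, Hom y z →ₗ[R] Hom x y →ₗ[R] Hom x z
  comp_mem : ∀ {x y z : Ob} (k l : ℤ) (g : Hom y z) (f : Hom x y), g ∈ gr y z k → f ∈ gr x y l →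
    comp g f ∈ gr x z (k + l)
  assoc : ∀ {x y z t : Ob} (h : Hom z t) (g : Hom y z) (f : Hom x y),
    comp (comp h g) f = comp h (comp g f)
  one : ∀ x : Ob, Hom x x
  one_mem : ∀ x : Ob, one x ∈ gr x x 0
  one_comp : ∀ {x y : Ob} (f : Hom x y), comp (one y) f = f
  comp_one : ∀ {x y : Ob} (f : Hom x y), comp f (one x) = f
  leibniz : ∀ {x y z : Ob} (k : ℤ) (g : Hom y z) (f : Hom x y), g ∈ gr y z k →
    d (comp g f) = comp (d g) f + k.negOnePow • comp g (d f)

section DG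

variable {R : Type w} [CommRing R]

/-- A DG category has a nice unit. -/
def DGCat.HasNiceUnit (C : DGCat.{u, v} R) : Prop := C.toGradedQuiver.IsNiceUnit C.one

/-- The composition of a sequence of homogeneous morphisms (the unit, if it is empty). -/
def DGCat.compSeq (C : DGCat.{u, v} R) : {x y : C.Ob} → CSeq C.Arrow x y → C.Hom x y
  | _, _, .nil x => C.one x
  | _, _, .snoc p f => C.comp (DGCat.compSeq C p) f.val

variable (C : DGCat.{u, v} R) (N : ∀ x y, Submodule R (C.Hom x y))
  (S : ∀ x y, Set (C.Arrow x y))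

/-- Words in the labels of the quiver `N + R·S`. -/
abbrev ExtWord : C.Ob → C.Ob → Type (max u v) := CSeq (C.toGradedQuiver.Label N S)

/-- The morphism of `C` named by a word. -/
def ExtWord.eval {x y : C.Ob} (p : ExtWord C N S x y) : C.Hom x y :=
  C.compSeq (p.mapId GradedQuiver.Label.arrow)

/-- The formal linear combination consisting of the single word `(a, b, c)`, for `b` in `N`. -/
noncomputable def ExtWord.old {x x' y' y : C.Ob} (a : ExtWord C N S y' y) (b : C.SubArrow N x' y')
    (c : ExtWord C N S x x') : ExtWord C N S x y →₀ R :=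
  Finsupp.single (a.ins (.old b) c) 1

/-- The relations that hold in the graded category freely generated over the graded subcategory `N`
by the set `S`, between linear combinations of words: multilinearity, and compatibility with the
compositions and units of `N`. -/
inductive ExtWordRel : {x y : C.Ob} → (ExtWord C N S x y →₀ R) → Prop
  | label_add {x x' y' y : C.Ob} (a : ExtWord C N S y' y) (c : ExtWord C N S x x')
      (f g h : C.SubArrow N x' y') :
      f.val.deg = h.val.deg → g.val.deg = h.val.deg → h.val.val = f.val.val + g.val.val →
      ExtWordRel (ExtWord.old C N S a h c - (ExtWord.old C N S a f c + ExtWord.old C N S a g c))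
  | label_smul {x x' y' y : C.Ob} (a : ExtWord C N S y' y) (c : ExtWord C N S x x') (r : R)
      (f h : C.SubArrow N x' y') :
      f.val.deg = h.val.deg → h.val.val = r • f.val.val →
      ExtWordRel (ExtWord.old C N S a h c - r • ExtWord.old C N S a f c)
  | comp {x x' z y' y : C.Ob} (a : ExtWord C N S y' y) (c : ExtWord C N S x x')
      (g : C.SubArrow N z y') (f : C.SubArrow N x' z) (h : C.SubArrow N x' y') :
      h.val.deg = g.val.deg + f.val.deg → h.val.val = C.comp g.val.val f.val.val →
      ExtWordRel (ExtWord.old C N S (a.snoc (.old g)) f c - ExtWord.old C N S a h c)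
  | one {x z y : C.Ob} (a : ExtWord C N S z y) (c : ExtWord C N S x z) (e : C.SubArrow N z z) :
      e.val = ⟨0, C.one z, C.one_mem z⟩ →
      ExtWordRel (ExtWord.old C N S a e c - Finsupp.single (a.append c) 1)

/-- `N'` is freely generated, as a graded category, over `N` by the set `S` of homogeneous
morphisms: evaluation of words is an isomorphism from the graded category defined by the above
generators and relations onto `N'`. -/
def IsFreeDGExtension (N' : ∀ x y, Submodule R (C.Hom x y)) : Prop :=
  ∀ x y : C.Ob,
    LinearMap.range (Finsupp.linearCombination R
      fun p : ExtWord C N S x y => ExtWord.eval C N S p) = N' x y ∧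
    LinearMap.ker (Finsupp.linearCombination R
      fun p : ExtWord C N S x y => ExtWord.eval C N S p) =
        Submodule.span R {e | ExtWordRel C N S e}

/-- A filtration exhibiting a DG category as semi-free (over its discrete category): an increasing
exhaustive sequence of DG subcategories with all objects, starting with the isomorphic image of the
discrete category, each freely generated as a graded category over the previous one by a set of
homogeneous morphisms whose differential lies in the previous one. -/
structure SemiFreeDGFiltration (C : DGCat.{u, v} R) where
  N : ℕ → ∀ x y, Submodule R (C.Hom x y)
  graded : ∀ n, C.IsGradedSub (N n)
  comp_closed : ∀ (n : ℕ) {x y z : C.Ob} (g : C.Hom y z) (f : C.Hom x y),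
    g ∈ N n y z → f ∈ N n x y → C.comp g f ∈ N n x z
  d_closed : ∀ (n : ℕ) {x y : C.Ob} (f : C.Hom x y), f ∈ N n x y → C.d f ∈ N n x y
  mono : ∀ (n : ℕ) (x y : C.Ob), N n x y ≤ N (n + 1) x y
  exhaustive : ∀ (x y : C.Ob) (f : C.Hom x y), ∃ n, f ∈ N n x y
  zero_diag : ∀ x : C.Ob, N 0 x x = Submodule.span R {C.one x}
  zero_inj : ∀ x : C.Ob, Function.Injective fun r : R => r • C.one x
  zero_off : ∀ x y : C.Ob, x ≠ y → N 0 x y = ⊥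
  S : ℕ → ∀ x y, Set (C.Arrow x y)
  d_mem : ∀ (n : ℕ) (x y : C.Ob), ∀ s ∈ S n x y, C.d s.val ∈ N n x y
  free : ∀ n, IsFreeDGExtension C (N n) (S n) (N (n + 1))

/-- Semi-free DG categories. -/
def DGCat.IsSemiFree (C : DGCat.{u, v} R) : Prop := Nonempty (SemiFreeDGFiltration C)

/-- A DG functor. -/
structure DGFunctor (A : DGCat.{u, v} R) (B : DGCat.{u', v'} R) where
  obj : A.Ob → B.Ob
  map : ∀ {x y : A.Ob}, A.Hom x y →ₗ[R] B.Hom (obj x) (obj y)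
  map_mem : ∀ {x y : A.Ob} (k : ℤ) (f : A.Hom x y), f ∈ A.gr x y k →
    map f ∈ B.gr (obj x) (obj y) k
  map_d : ∀ {x y : A.Ob} (f : A.Hom x y), map (A.d f) = B.d (map f)
  map_comp : ∀ {x y z : A.Ob} (g : A.Hom y z) (f : A.Hom x y),
    map (A.comp g f) = B.comp (map g) (map f)
  map_one : ∀ x : A.Ob, map (A.one x) = B.one (obj x)

/-- A homogeneous morphism of degree `k` is the differential of one of degree `k - 1`. -/
def DGCat.IsExact (A : DGCat.{u, v} R) {x y : A.Ob} (k : ℤ) (f : A.Hom x y) : Prop :=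
  ∃ h ∈ A.gr x y (k - 1), A.d h = f

/-- Objects that become isomorphic in the category `H⁰`. -/
def DGCat.H0Iso (B : DGCat.{u, v} R) (x y : B.Ob) : Prop :=
  ∃ f ∈ B.gr x y 0, ∃ g ∈ B.gr y x 0, B.d f = 0 ∧ B.d g = 0 ∧
    B.IsExact 0 (B.comp g f - B.one x) ∧ B.IsExact 0 (B.comp f g - B.one y)

/-- A quasi-equivalence of DG categories. -/
def DGFunctor.IsQuasiEquivalence {A : DGCat.{u, v} R} {B : DGCat.{u', v'} R}
    (F : DGFunctor A B) : Prop :=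
  (∀ (x y : A.Ob) (k : ℤ), ∀ f ∈ A.gr x y k, A.d f = 0 →
    B.IsExact k (F.map f) → A.IsExact k f) ∧
  (∀ (x y : A.Ob) (k : ℤ), ∀ g ∈ B.gr (F.obj x) (F.obj y) k, B.d g = 0 →
    ∃ f ∈ A.gr x y k, A.d f = 0 ∧ B.IsExact k (F.map f - g)) ∧
  ∀ z : B.Ob, ∃ x : A.Ob, B.H0Iso (F.obj x) z

/-- A semi-free resolution of a DG category. -/
structure SemiFreeDGResolution (A : DGCat.{u, v} R) where
  cat : DGCat.{u', v'} R
  semiFree : cat.IsSemiFree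
  functor : DGFunctor cat A
  quasiEquivalence : functor.IsQuasiEquivalence

end DG

end AInfty

namespace AInfty

/-! ### Graded modules -/

section Graded

variable {R : Type*} [CommRing R] {M M' : Type*} [AddCommGroup M] [Module R M]
  [AddCommGroup M'] [Module R M']

-- A free extension retracts onto its base by killing the new generators. Each step `N (n + 1)` is
-- presented by trees (in the DG case, words) in labels from `N n` and `S n`, modulo explicit
-- relations. Sending every element of `S n` to zero and fixing `N n` respects these relations,
-- since they involve only morphisms and units of `N n` and hold in the ambient category. This gives
-- a graded linear map `N (n + 1) → N n` that is the identity on `N n` (`exists_graded_retraction`).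
-- It need not commute with the differential, as `d s` may be nonzero for `s` in `S n`. This does no
-- harm: the splitting is one of graded modules, and neither trees, whose nodes have at least two
-- inputs, nor words involve the differential. Composing these maps down the exhaustive filtration
-- retracts `Hom(x, x)` onto `N 0 x x = R · 1` (`exists_graded_retraction_of_filtration`). The
-- isomorphism of `R · 1` with `R` is the injectivity of `r ↦ r • 1` in the definition of the
-- discrete category.

/-- A linear map out of an internally graded module may be prescribed in each degree. -/
theorem exists_linearMap_of_isInternal {gr : ℤ → Submodule R M} (h : DirectSum.IsInternal gr)
    (φ : ∀ k, gr k →ₗ[R] M') : ∃ Φ : M →ₗ[R] M', ∀ (k : ℤ) (f : gr k), Φ f = φ k f := by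
  classical
  let e := LinearEquiv.ofBijective (DirectSum.coeLinearMap gr) h
  refine ⟨DirectSum.toModule R ℤ M' φ ∘ₗ e.symm.toLinearMap, fun k f => ?_⟩
  have : e.symm (f : M) = DirectSum.lof R ℤ (fun k => gr k) k f := by
    rw [LinearEquiv.symm_apply_eq]
    exact (DirectSum.coeLinearMap_lof gr k f).symm
  simp [this]

/-- The projection of an internally graded module onto its component of degree `k`. -/
theorem exists_component_of_isInternal {gr : ℤ → Submodule R M} (h : DirectSum.IsInternal gr)
    (k : ℤ) : ∃ p : M →ₗ[R] M, (∀ f ∈ gr k, p f = f) ∧ ∀ l ≠ k, ∀ f ∈ gr l, p f = 0 := by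
  classical
  obtain ⟨p, hp⟩ := exists_linearMap_of_isInternal h
    fun l => if l = k then (gr l).subtype else 0
  refine ⟨p, fun f hf => ?_, fun l hl f hf => ?_⟩
  · simpa using hp k ⟨f, hf⟩
  · simpa [hl] using hp l ⟨f, hf⟩

/-- Let `N'` be spanned by homogeneous elements `ev t`, and let `ev' t` be elements of the same
degrees in `N` that satisfy all the linear relations between the `ev t`. If every homogeneous
element of `N` is some `ev t = ev' t`, then `ev t ↦ ev' t` is a graded retraction of `N'` on `N`. -/
theorem exists_graded_retraction {gr : ℤ → Submodule R M} (h : DirectSum.IsInternal gr)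
    {N N' : Submodule R M} {T : Type*} (deg : T → ℤ) (ev ev' : T → M)
    (hev : ∀ t, ev t ∈ gr (deg t)) (hev' : ∀ t, ev' t ∈ gr (deg t)) (hN : ∀ t, ev' t ∈ N)
    (hrange : LinearMap.range (Finsupp.linearCombination R ev) = N')
    (hker : ∀ e, Finsupp.linearCombination R ev e = 0 → Finsupp.linearCombination R ev' e = 0)
    (hgr : N ≤ ⨆ k : ℤ, N ⊓ gr k)
    (hold : ∀ k, ∀ f ∈ N ⊓ gr k, ∃ t, ev t = f ∧ ev' t = f) :
    ∃ π : N' →ₗ[R] N, (∀ f : N', (f : M) ∈ N → (π f : M) = f) ∧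
      ∀ k, ∀ f : N', (f : M) ∈ gr k → (π f : M) ∈ gr k := by
  classical
  subst hrange
  let L := Finsupp.linearCombination R ev
  have hL' : ∀ e, Finsupp.linearCombination R ev' e ∈ N := fun e => by
    rw [Finsupp.linearCombination_apply]
    exact N.sum_mem fun t _ => N.smul_mem _ (hN t)
  let L' : (T →₀ R) →ₗ[R] N := (Finsupp.linearCombination R ev').codRestrict N hL'
  have hle : LinearMap.ker L ≤ LinearMap.ker L' := fun e he => by
    rw [LinearMap.mem_ker] at he ⊢
    exact Subtype.ext (hker e he)
  -- `N'` is the quotient of the formal combinations by `ker L`, so `ev t ↦ ev' t` descends to it.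
  let π : LinearMap.range L →ₗ[R] N :=
    (LinearMap.ker L).liftQ L' hle ∘ₗ L.quotKerEquivRange.symm.toLinearMap
  have hπ : ∀ e (he : L e ∈ LinearMap.range L),
      (π ⟨L e, he⟩ : M) = Finsupp.linearCombination R ev' e := fun e he => by
    have : L.quotKerEquivRange.symm ⟨L e, he⟩ = (LinearMap.ker L).mkQ e := by
      rw [LinearEquiv.symm_apply_eq]
      exact Subtype.ext rfl
    simp only [π, LinearMap.comp_apply, LinearEquiv.coe_coe, this, Submodule.mkQ_apply,
      Submodule.liftQ_apply]
    rfl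
  refine ⟨π, ?_, ?_⟩
  · rintro ⟨f, hf⟩ hfN
    -- An element of `N` need not be homogeneous, while `hold` treats only homogeneous ones. The
    -- locus where `π` agrees with the inclusion is a submodule, so it contains `N` once it contains
    -- every `N ⊓ gr k`.
    have key : f ∈ Submodule.map (LinearMap.range L).subtype
        (LinearMap.eqLocus (N.subtype ∘ₗ π) (LinearMap.range L).subtype) := by
      refine (iSup_le fun k => ?_ : (⨆ k : ℤ, N ⊓ gr k) ≤ _) (hgr hfN)
      intro g hg
      obtain ⟨t, rfl, ht⟩ := hold k g hg
      have hLt : L (Finsupp.single t 1) = ev t := by simp [L]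
      have hmem : ev t ∈ LinearMap.range L := ⟨_, hLt⟩
      refine ⟨⟨ev t, hmem⟩, ?_, rfl⟩
      have := hπ (Finsupp.single t 1) (hLt ▸ hmem)
      simp only [hLt, Finsupp.linearCombination_single, one_smul, ht] at this
      exact this
    obtain ⟨⟨g, hg⟩, hg', rfl⟩ := key
    exact hg'
  · rintro k ⟨f, e, rfl⟩ hf
    obtain ⟨p, hp, hp0⟩ := exists_component_of_isInternal h k
    -- The combination `e` may contain terms of other degrees whose values cancel. Projecting to
    -- degree `k` shows that they can be dropped.
    have hfil : L (e.filter fun t => deg t = k) = L e := by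
      have h1 : ∀ t, p (ev t) = if deg t = k then ev t else 0 := fun t => by
        split_ifs with ht
        · exact hp _ (ht ▸ hev t)
        · exact hp0 _ ht _ (hev t)
      have hf' : L e ∈ gr k := hf
      conv_rhs => rw [← hp _ hf']
      simp only [L, Finsupp.linearCombination_apply, Finsupp.sum, map_sum, map_smul, h1,
        Finsupp.support_filter, smul_ite, smul_zero, Finset.sum_filter]
      refine Finset.sum_congr rfl fun t _ => ?_
      split_ifs with ht
      · rw [Finsupp.filter_apply_pos (fun t => deg t = k) e ht]
      · rfl
    have hmem := LinearMap.mem_range_self L (e.filter fun t => deg t = k)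
    have : (⟨L e, ⟨e, rfl⟩⟩ : LinearMap.range L) = ⟨_, hmem⟩ := Subtype.ext hfil.symm
    change (π ⟨L e, ⟨e, rfl⟩⟩ : M) ∈ gr k
    rw [this, hπ, Finsupp.linearCombination_apply]
    refine (gr k).sum_mem fun t ht => (gr k).smul_mem _ ?_
    rw [Finsupp.support_filter, Finset.mem_filter] at ht
    exact ht.2 ▸ hev' t

/-- Graded retractions of each step of an exhaustive filtration on the previous one compose to a
graded retraction on the first step. -/
theorem exists_graded_retraction_of_filtration (gr : ℤ → Submodule R M) (N : ℕ → Submodule R M)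
    (mono : ∀ n, N n ≤ N (n + 1)) (exhaustive : ∀ f, ∃ n, f ∈ N n)
    (step : ∀ n, ∃ π : N (n + 1) →ₗ[R] N n, (∀ f : N (n + 1), (f : M) ∈ N n → (π f : M) = f) ∧
      ∀ k, ∀ f : N (n + 1), (f : M) ∈ gr k → (π f : M) ∈ gr k) :
    ∃ ρ : M →ₗ[R] N 0, (∀ f : N 0, ρ f = f) ∧ ∀ k, ∀ f ∈ gr k, (ρ f : M) ∈ gr k := by
  choose π hid hgr using step
  let r : ∀ n, N n →ₗ[R] N 0 := fun n =>
    Nat.rec (motive := fun n => N n →ₗ[R] N 0) LinearMap.id (fun n rn => rn ∘ₗ π n) n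
  have hmono : Monotone N := monotone_nat_of_le_succ mono
  -- The composites `r n : N n → N 0` are compatible because each `π` fixes the previous step. Hence
  -- `r (i f)` does not depend on the choice of the index `i f`.
  have hr : ∀ n m (hnm : n ≤ m) (f : M) (hf : f ∈ N n), r m ⟨f, hmono hnm hf⟩ = r n ⟨f, hf⟩ := by
    intro n m hnm f hf
    induction m, hnm using Nat.le_induction with
    | base => rfl
    | succ m hnm ih =>
      rw [← ih]
      change r m (π m _) = _
      congr 1
      exact Subtype.ext (hid m _ (hmono hnm hf))
  have hrgr : ∀ n k (f : N n), (f : M) ∈ gr k → (r n f : M) ∈ gr k := by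
    intro n k
    induction n with
    | zero => exact fun f hf => hf
    | succ n ih => exact fun f hf => ih _ (hgr n k f hf)
  choose i hi using exhaustive
  have hri : ∀ n f (hf : f ∈ N n), r (i f) ⟨f, hi f⟩ = r n ⟨f, hf⟩ := fun n f hf => by
    rw [← hr _ _ (le_max_left (i f) n) f (hi f), ← hr _ _ (le_max_right (i f) n) f hf]
  refine ⟨{ toFun := fun f => r (i f) ⟨f, hi f⟩, map_add' := fun f g => ?_,
            map_smul' := fun a f => ?_ }, fun f => ?_, fun k f hf => ?_⟩
  · have hf := hmono (le_max_left (i f) (i g)) (hi f)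
    have hg := hmono (le_max_right (i f) (i g)) (hi g)
    rw [hri _ f hf, hri _ g hg, hri _ (f + g) (add_mem hf hg), ← map_add]
    rfl
  · rw [hri _ (a • f) ((N (i f)).smul_mem a (hi f)), RingHom.id_apply, ← map_smul]
    rfl
  · exact hri 0 f f.2
  · exact hrgr _ k _ hf

end Graded

/-- A unit which freely spans the first step of a filtration by submodules is nice, if each step of
the filtration has a graded retraction on the previous one. -/
theorem GradedQuiver.isNiceUnit_of_filtration {R : Type w} [CommRing R]
    (Q : GradedQuiver.{u, v} R) (one : ∀ x, Q.Hom x x) (N : ℕ → ∀ x y, Submodule R (Q.Hom x y))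
    (mono : ∀ n x y, N n x y ≤ N (n + 1) x y) (exhaustive : ∀ x y f, ∃ n, f ∈ N n x y)
    (zero_diag : ∀ x, N 0 x x = Submodule.span R {one x})
    (zero_inj : ∀ x, Function.Injective fun r : R => r • one x)
    (step : ∀ n x y, ∃ π : N (n + 1) x y →ₗ[R] N n x y,
      (∀ f : N (n + 1) x y, (f : Q.Hom x y) ∈ N n x y → (π f : Q.Hom x y) = f) ∧
      ∀ k, ∀ f : N (n + 1) x y, (f : Q.Hom x y) ∈ Q.gr x y k → (π f : Q.Hom x y) ∈ Q.gr x y k) :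
    Q.IsNiceUnit one := by
  intro x
  constructor
  · have hinj : Function.Injective (LinearMap.toSpanSingleton R (Q.Hom x x) (one x)) := zero_inj x
    exact ⟨((LinearEquiv.ofInjective _ hinj).trans (LinearEquiv.ofEq _ _
      (LinearMap.span_singleton_eq_range R (Q.Hom x x) (one x)).symm)).symm⟩
  · rw [← zero_diag x]
    exact exists_graded_retraction_of_filtration (Q.gr x x) (fun n => N n x x)
      (fun n => mono n x x) (exhaustive x x) fun n => step n x x

/-! ### Composable sequences -/

namespace CSeq

variable {V : Type u} {H : V → V → Type v} {K : V → V → Type v'}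

theorem mapId_append (φ : ∀ {x y : V}, H x y → K x y) {y z : V} (a : CSeq H y z) :
    ∀ {x : V} (c : CSeq H x y),
      (a.append c).mapId φ = (a.mapId φ).append (c.mapId φ)
  | _, nil _ => rfl
  | _, snoc c f => by
    change snoc ((a.append c).mapId φ) (φ f) = snoc ((a.mapId φ).append (c.mapId φ)) (φ f)
    rw [mapId_append]

theorem mapId_ins (φ : ∀ {x y : V}, H x y → K x y) {x x' y' y : V} (a : CSeq H y' y)
    (f : H x' y') (c : CSeq H x x') :
    (a.ins f c).mapId φ = (a.mapId φ).ins (φ f) (c.mapId φ) :=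
  mapId_append φ _ c

theorem length_append {y z : V} (a : CSeq H y z) :
    ∀ {x : V} (c : CSeq H x y), (a.append c).length = a.length + c.length
  | _, nil _ => rfl
  | _, snoc c f => by
    change (a.append c).length + 1 = a.length + (c.length + 1)
    rw [length_append, add_assoc]

theorem length_ins {x x' y' y : V} (a : CSeq H y' y) (f : H x' y') (c : CSeq H x x') :
    (a.ins f c).length = a.length + c.length + 1 := by
  rw [ins, length_append, length]
  omega

end CSeq

-- Killing the new generators, on labels

section Labels

variable {R : Type w} [CommRing R]

/-- The homogeneous morphism named by a label of the quiver `N + R·S`, after the projection that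
kills `S`. -/
def GradedQuiver.Label.killNew {Q : GradedQuiver.{u, v} R} {N : ∀ x y, Submodule R (Q.Hom x y)}
    {S : ∀ x y, Set (Q.Arrow x y)} {x y : Q.Ob} : Q.Label N S x y → Q.Arrow x y
  | .old b => b.val
  -- Zero lies in every degree. Keeping the degree of `s` leaves the degrees of all trees and words,
  -- and so the signs in the unit relations, unchanged.
  | .new s => ⟨s.val.deg, 0, zero_mem _⟩

theorem GradedQuiver.Label.killNew_deg {Q : GradedQuiver.{u, v} R}
    {N : ∀ x y, Submodule R (Q.Hom x y)} {S : ∀ x y, Set (Q.Arrow x y)} {x y : Q.Ob}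
    (l : Q.Label N S x y) : l.killNew.deg = l.arrow.deg := by
  cases l <;> rfl

theorem GradedQuiver.Label.killNew_mem {Q : GradedQuiver.{u, v} R}
    {N : ∀ x y, Submodule R (Q.Hom x y)} {S : ∀ x y, Set (Q.Arrow x y)} {x y : Q.Ob}
    (l : Q.Label N S x y) : l.killNew.val ∈ N x y := by
  cases l with
  | old b => exact b.2
  | new s => exact zero_mem _

end Labels

/-! ### Evaluation of trees -/

namespace PTree

variable {R : Type w} [CommRing R] (C : AInfCat.{u, v} R) {L : C.Ob → C.Ob → Type v'}
  (φ ψ : ∀ {x y : C.Ob}, L x y → C.Arrow x y)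

/-- Replaces the mutually recursive, universe-lifted evaluation of sequences by a plain `mapId`, to
which the structural lemmas on sequences apply. -/
theorem evalSeq_eq_mapId : ∀ {x y : C.Ob} (p : CSeq (PTree L) x y),
    evalSeq C φ p = p.mapId fun t => eval C φ t
  | _, _, .nil _ => by simp [evalSeq, CSeq.mapId]
  | _, _, .snoc p t => by
    simp only [evalSeq, CSeq.mapId, evalSeq_eq_mapId p]
    rfl

theorem eval_leaf {x y : C.Ob} (l : L x y) : eval C φ (.leaf l) = φ l := by
  simp [eval, evalLift]

theorem eval_graft {x y : C.Ob} (p : CSeq (PTree L) x y) (hp : 2 ≤ p.length) :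
    eval C φ (graft p hp) = C.mArrow (p.mapId fun t => eval C φ t) := by
  match p, hp with
  | .snoc (.snoc p s) t, _ =>
    simp only [graft, CSeq.mapId, ← evalSeq_eq_mapId]
    rw [eval, evalLift]
    rfl

theorem eval_node {a b c d : C.Ob} (p : CSeq (PTree L) c d) (s : PTree L b c) (t : PTree L a b) :
    eval C φ (.node p s t) =
      C.mArrow (.snoc (.snoc (p.mapId fun t => eval C φ t) (eval C φ s)) (eval C φ t)) := by
  rw [← evalSeq_eq_mapId, eval, evalLift]
  rfl

/-- The degree of the value of a tree depends only on the degrees of the labels. -/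
theorem eval_deg (h : ∀ {x y : C.Ob} (l : L x y), (φ l).deg = (ψ l).deg) {x y : C.Ob}
    (t : PTree L x y) : (eval C φ t).deg = (eval C ψ t).deg := by
  -- `PTree` is nested through `CSeq`, so the recursor needs a second motive, for sequences: the
  -- shifted degree, on which alone the degree of `m` depends.
  refine PTree.rec
    (motive_1 := fun _ _ t => (eval C φ t).deg = (eval C ψ t).deg)
    (motive_2 := fun _ _ p => (p.mapId fun t => eval C φ t).sdeg =
      (p.mapId fun t => eval C ψ t).sdeg) ?_ ?_ ?_ ?_ t
  · intro x y l
    simpa only [eval_leaf] using h l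
  · intro a b c d p s t hp hs ht
    simp only [eval_node, AInfCat.mArrow, CSeq.sdeg, hp, hs, ht]
  · intro x
    rfl
  · intro x y z p t hp ht
    simp only [CSeq.mapId, CSeq.sdeg, hp, ht]

/-- The value of a tree lies in any `A∞`-subcategory that contains the labels. -/
theorem eval_mem (N : ∀ x y, Submodule R (C.Hom x y))
    (closed : ∀ {x y : C.Ob} (p : CSeq (C.SubArrow N) x y), C.m (p.mapId fun f => f.val) ∈ N x y)
    (h : ∀ {x y : C.Ob} (l : L x y), (φ l).val ∈ N x y) {x y : C.Ob} (t : PTree L x y) :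
    (eval C φ t).val ∈ N x y := by
  refine PTree.rec
    (motive_1 := fun x y t => (eval C φ t).val ∈ N x y)
    -- `closed` speaks of sequences of arrows bundled with membership in `N`, so the induction
    -- carries such a lift.
    (motive_2 := fun x y p => ∃ q : CSeq (C.SubArrow N) x y,
      (q.mapId fun f => f.val) = p.mapId fun t => eval C φ t) ?_ ?_ ?_ ?_ t
  · intro x y l
    simpa only [eval_leaf] using h l
  · intro a b c d p s t ⟨q, hq⟩ hs ht
    rw [eval_node, ← hq]
    exact closed (.snoc (.snoc q ⟨_, hs⟩) ⟨_, ht⟩)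
  · exact fun x => ⟨.nil x, rfl⟩
  · intro x y z p t ⟨q, hq⟩ ht
    exact ⟨.snoc q ⟨_, ht⟩, by simp only [CSeq.mapId, hq]⟩

end PTree

/-! ### Semi-free A∞-categories -/

section AInfinity

variable {R : Type w} [CommRing R]

/-- The operation `f ↦ m(a, f, c)`, extended linearly to morphisms that need not be homogeneous. -/
theorem AInfCat.exists_m_ins (C : AInfCat.{u, v} R) {x x' y' y : C.Ob} (a : CSeq C.Arrow y' y)
    (c : CSeq C.Arrow x x') : ∃ Φ : C.Hom x' y' →ₗ[R] C.Hom x y,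
      ∀ f : C.Arrow x' y', C.m (a.ins f c) = Φ f.val := by
  -- `m` is additive only between arrows of equal degree, so the map is built degree by degree.
  obtain ⟨Φ, hΦ⟩ := exists_linearMap_of_isInternal (C.internal x' y') fun k =>
    ({ toFun := fun f => C.m (a.ins ⟨k, f.1, f.2⟩ c)
       map_add' := fun f g => C.m_add a c ⟨k, f.1, f.2⟩ ⟨k, g.1, g.2⟩ _ rfl rfl rfl
       map_smul' := fun r f => C.m_smul a c r ⟨k, f.1, f.2⟩ _ rfl rfl } :
      C.gr x' y' k →ₗ[R] C.Hom x y)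
  exact ⟨Φ, fun f => (hΦ f.deg ⟨f.val, f.mem⟩).symm⟩

variable (C : SUAInfCat.{u, v} R) (N : ∀ x y, Submodule R (C.Hom x y))
  (S : ∀ x y, Set (C.Arrow x y))

/-- The value of a labelled tree after the projection `N + R·S → N`. -/
def ExtTree.evalKill {x y : C.Ob} (t : ExtTree C N S x y) : C.Arrow x y :=
  PTree.eval C.toAInfCat GradedQuiver.Label.killNew t

theorem ExtTree.evalKill_deg {x y : C.Ob} (t : ExtTree C N S x y) :
    (t.evalKill C N S).deg = (t.eval C N S).deg :=
  PTree.eval_deg C.toAInfCat _ _ GradedQuiver.Label.killNew_deg t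

theorem ExtTree.evalKill_old {x y : C.Ob} (b : C.SubArrow N x y) :
    (ExtTree.old C N S b).evalKill C N S = b.val :=
  PTree.eval_leaf _ _ _

theorem ExtTree.eval_old {x y : C.Ob} (b : C.SubArrow N x y) :
    (ExtTree.old C N S b).eval C N S = b.val :=
  PTree.eval_leaf _ _ _

/-- The projection `N + R·S → N` induces a map on `F(N + R·S)/I`. -/
theorem ExtIdeal.evalKill_eq_zero {x y : C.Ob} {e : ExtTree C N S x y →₀ R}
    (he : ExtIdeal C N S e) :
    Finsupp.linearCombination R (fun t => (ExtTree.evalKill C N S t).val) e = 0 := by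
  induction he with
  | zero => exact map_zero _
  | add a b _ _ iha ihb => rw [map_add, iha, ihb, add_zero]
  | smul r a _ ih => rw [map_smul, ih, smul_zero]
  | graft a c h e _ ih =>
    -- The trees in `e` may have different degrees, so grafting has to become a linear map `Φ` on
    -- the whole hom-module; applying `Φ` to the induction hypothesis gives the claim.
    obtain ⟨Φ, hΦ⟩ := C.exists_m_ins (a.mapId fun t => ExtTree.evalKill C N S t)
      (c.mapId fun t => ExtTree.evalKill C N S t)
    have key : ∀ t, (ExtTree.evalKill C N S (PTree.graft (a.ins t c) (h t))).val =
        Φ (ExtTree.evalKill C N S t).val := fun t => by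
      rw [← hΦ, ExtTree.evalKill, PTree.eval_graft, CSeq.mapId_ins]
      rfl
    have h0 := congrArg Φ ih
    rw [map_zero, Finsupp.linearCombination_apply, Finsupp.sum, map_sum] at h0
    rw [Finsupp.linearCombination_mapDomain, Finsupp.linearCombination_apply, Finsupp.sum, ← h0]
    exact Finset.sum_congr rfl fun t _ => by rw [map_smul, Function.comp_apply, key]
  | label_add f g h hf hg hh =>
    simp [ExtTree.evalKill_old, hh]
  | label_smul r f h hf hh =>
    simp [ExtTree.evalKill_old, hh]
  | op p hp b hb =>
    have : ∀ {x y : C.Ob} (p : CSeq (C.SubArrow N) x y),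
        ((p.mapId fun b => ExtTree.old C N S b).mapId fun t => ExtTree.evalKill C N S t) =
          p.mapId fun f => f.val := by
      intro x y p
      induction p with
      | nil => rfl
      | snoc p f ih => simp only [CSeq.mapId, ih, ExtTree.evalKill_old]
    have key : ExtTree.evalKill C N S (PTree.graft (p.mapId fun b => ExtTree.old C N S b) hp) =
        b.val := by
      rw [hb, ← this p]
      exact PTree.eval_graft _ _ _ _
    simp [ExtTree.evalKill_old, key]
  | @right_one x y t e he =>
    have key : (ExtTree.evalKill C N S (PTree.node (.nil y) t (ExtTree.old C N S e))).val =
        (ExtTree.evalKill C N S t).val := by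
      refine Eq.trans ?_ (C.m_right_one (ExtTree.evalKill C N S t))
      rw [ExtTree.evalKill, PTree.eval_node]
      change C.m (.snoc (.snoc (.nil y) (ExtTree.evalKill C N S t))
        (ExtTree.evalKill C N S (ExtTree.old C N S e))) = _
      rw [ExtTree.evalKill_old, he]
      rfl
    simp [key]
  | @left_one x y t e he =>
    have key : (ExtTree.evalKill C N S (PTree.node (.nil y) (ExtTree.old C N S e) t)).val =
        (ExtTree.eval C N S t).deg.negOnePow • (ExtTree.evalKill C N S t).val := by
      -- The relation carries the sign of the original tree, the unit law in `C` that of the killed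
      -- one; they agree because killing preserves degrees.
      rw [← ExtTree.evalKill_deg]
      refine Eq.trans ?_ (C.m_left_one (ExtTree.evalKill C N S t))
      rw [ExtTree.evalKill, PTree.eval_node]
      change C.m (.snoc (.snoc (.nil y) (ExtTree.evalKill C N S (ExtTree.old C N S e)))
        (ExtTree.evalKill C N S t)) = _
      rw [ExtTree.evalKill_old, he]
      rfl
    -- The sign acts through the units of `ℤ`; fixing the parity turns it into `1` or `-1`, which
    -- passes through the `R`-linear map.
    rcases Int.even_or_odd (ExtTree.eval C N S t).deg with h | h
    · simp [key, Int.negOnePow_even _ h]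
    · simp [key, Int.negOnePow_odd _ h]
  | mid_one a c e h he =>
    have key : (ExtTree.evalKill C N S (PTree.graft (a.ins (ExtTree.old C N S e) c)
        (le_trans (by norm_num) h))).val = 0 := by
      have hl : ∀ {x y : C.Ob} (p : CSeq (ExtTree C N S) x y),
          (p.mapId fun t => ExtTree.evalKill C N S t).length = p.length := by
        intro x y p
        induction p with
        | nil => rfl
        | snoc p f ih => simp only [CSeq.mapId, CSeq.length, ih]
      -- The bound 3 counts the unit among the inputs, the bound 2 in `m_mid_one` only the remaining
      -- ones.
      rw [CSeq.length_ins] at h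
      refine Eq.trans ?_ (C.m_mid_one (a.mapId fun t => ExtTree.evalKill C N S t)
        (c.mapId fun t => ExtTree.evalKill C N S t) (by rw [hl, hl]; omega))
      rw [ExtTree.evalKill, PTree.eval_graft, CSeq.mapId_ins]
      change C.m (CSeq.ins _ (ExtTree.evalKill C N S (ExtTree.old C N S e)) _) = _
      rw [ExtTree.evalKill_old, he]
      rfl
    simp [key]

/-- Freeness makes the retraction well defined: a combination of trees with value zero lies in
`ExtIdeal`, which `evalKill` annihilates. Homogeneous elements of `N n` are one-leaf trees, and
these are fixed. -/
theorem SUAInfCat.IsSemiFree.hasNiceUnit {C : SUAInfCat.{u, v} R} (hC : C.IsSemiFree) :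
    C.HasNiceUnit := by
  obtain ⟨F⟩ := hC
  refine C.isNiceUnit_of_filtration C.one F.N F.mono F.exhaustive F.zero_diag F.zero_inj
    fun n x y => ?_
  refine exists_graded_retraction (C.internal x y)
    (fun t : ExtTree C (F.N n) (F.S n) x y => (t.eval C (F.N n) (F.S n)).deg)
    (fun t => (t.eval C (F.N n) (F.S n)).val) (fun t => (t.evalKill C (F.N n) (F.S n)).val)
    (fun t => (t.eval C (F.N n) (F.S n)).mem) (fun t => ?_)
    (fun t => PTree.eval_mem _ _ _ (F.closed n) GradedQuiver.Label.killNew_mem t)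
    (F.free n x y).1 (fun e he => ((F.free n x y).2 e |>.1 he).evalKill_eq_zero)
    (F.graded n x y) (fun k f hf => ?_)
  · rw [← ExtTree.evalKill_deg]
    exact (t.evalKill C (F.N n) (F.S n)).mem
  · refine ⟨ExtTree.old C (F.N n) (F.S n) ⟨⟨k, f, hf.2⟩, hf.1⟩, ?_, ?_⟩
    · exact congrArg GradedQuiver.Arrow.val (ExtTree.eval_old C (F.N n) (F.S n) _)
    · exact congrArg GradedQuiver.Arrow.val (ExtTree.evalKill_old C (F.N n) (F.S n) _)

end AInfinity

/-! ### Semi-free DG categories -/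

section DifferentialGraded

variable {R : Type w} [CommRing R] (C : DGCat.{u, v} R)

theorem DGCat.compSeq_append {y z : C.Ob} (a : CSeq C.Arrow y z) :
    ∀ {x : C.Ob} (c : CSeq C.Arrow x y),
      C.compSeq (a.append c) = C.comp (C.compSeq a) (C.compSeq c)
  | _, .nil _ => (C.comp_one _).symm
  | _, .snoc c f => by
    simp only [CSeq.append, DGCat.compSeq, DGCat.compSeq_append a c, C.assoc]

theorem DGCat.compSeq_ins {x x' y' y : C.Ob} (a : CSeq C.Arrow y' y) (f : C.Arrow x' y')
    (c : CSeq C.Arrow x x') :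
    C.compSeq (a.ins f c) = C.comp (C.comp (C.compSeq a) f.val) (C.compSeq c) :=
  C.compSeq_append _ c

/-- `sdeg` adds up the shifted degrees `deg - 1`; the length restores the sum of the degrees. -/
theorem DGCat.compSeq_mem : ∀ {x y : C.Ob} (p : CSeq C.Arrow x y),
    C.compSeq p ∈ C.gr x y (p.sdeg + p.length)
  | _, _, .nil x => by simpa [CSeq.sdeg, CSeq.length, DGCat.compSeq] using C.one_mem x
  | _, _, .snoc p f => by
    have h := C.comp_mem _ _ _ _ (DGCat.compSeq_mem p) f.mem
    have hd : (p.snoc f).sdeg + ((p.snoc f).length : ℤ) = p.sdeg + p.length + f.deg := by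
      simp only [CSeq.sdeg, CSeq.length]
      push_cast
      ring
    rw [hd]
    exact h

variable (N : ∀ x y, Submodule R (C.Hom x y)) (S : ∀ x y, Set (C.Arrow x y))

/-- The value of a word after the projection `N + R·S → N`. -/
def ExtWord.evalKill {x y : C.Ob} (p : ExtWord C N S x y) : C.Hom x y :=
  C.compSeq (p.mapId GradedQuiver.Label.killNew)

theorem ExtWord.evalKill_mem_gr {x y : C.Ob} (p : ExtWord C N S x y) :
    p.evalKill C N S ∈ C.gr x y ((p.mapId GradedQuiver.Label.arrow).sdeg +
      (p.mapId GradedQuiver.Label.arrow).length) := by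
  have h : (p.mapId GradedQuiver.Label.killNew).sdeg = (p.mapId GradedQuiver.Label.arrow).sdeg ∧
      (p.mapId GradedQuiver.Label.killNew).length =
        (p.mapId GradedQuiver.Label.arrow).length := by
    induction p with
    | nil => exact ⟨rfl, rfl⟩
    | snoc p f ih =>
      simp only [CSeq.mapId, CSeq.sdeg, CSeq.length, ih.1, ih.2,
        GradedQuiver.Label.killNew_deg, and_self]
  rw [← h.1, ← h.2]
  exact C.compSeq_mem _

theorem ExtWord.evalKill_mem (one_mem : ∀ x, C.one x ∈ N x x)
    (comp_mem : ∀ {x y z : C.Ob} (g : C.Hom y z) (f : C.Hom x y),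
      g ∈ N y z → f ∈ N x y → C.comp g f ∈ N x z) :
    ∀ {x y : C.Ob} (p : ExtWord C N S x y), p.evalKill C N S ∈ N x y
  | _, _, .nil x => one_mem x
  | _, _, .snoc p f => comp_mem _ _ (ExtWord.evalKill_mem one_mem comp_mem p) f.killNew_mem

theorem ExtWord.evalKill_ins_old {x x' y' y : C.Ob} (a : ExtWord C N S y' y)
    (b : C.SubArrow N x' y') (c : ExtWord C N S x x') :
    ExtWord.evalKill C N S (a.ins (.old b) c) =
      C.comp (C.comp (a.evalKill C N S) b.val.val) (c.evalKill C N S) := by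
  rw [ExtWord.evalKill, CSeq.mapId_ins, C.compSeq_ins]
  rfl

/-- The projection `N + R·S → N` respects the relations between words. -/
theorem ExtWordRel.evalKill_eq_zero {x y : C.Ob} {e : ExtWord C N S x y →₀ R}
    (he : ExtWordRel C N S e) :
    Finsupp.linearCombination R (fun p => ExtWord.evalKill C N S p) e = 0 := by
  cases he with
  | label_add a c f g h hf hg hh =>
    simp [ExtWord.old, ExtWord.evalKill_ins_old, hh]
  | label_smul a c r f h hf hh =>
    simp [ExtWord.old, ExtWord.evalKill_ins_old, hh]
  | comp a c g f h hd hh =>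
    have : ExtWord.evalKill C N S (a.snoc (.old g)) =
        C.comp (ExtWord.evalKill C N S a) g.val.val := rfl
    simp [ExtWord.old, ExtWord.evalKill_ins_old, hh, this, C.assoc]
  | one a c e he =>
    have : ExtWord.evalKill C N S (a.append c) =
        C.comp (ExtWord.evalKill C N S a) (ExtWord.evalKill C N S c) := by
      rw [ExtWord.evalKill, CSeq.mapId_append, C.compSeq_append]
      rfl
    simp [ExtWord.old, ExtWord.evalKill_ins_old, he, this, C.comp_one]

theorem DGCat.IsSemiFree.hasNiceUnit {C : DGCat.{u, v} R} (hC : C.IsSemiFree) :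
    C.HasNiceUnit := by
  obtain ⟨F⟩ := hC
  -- The empty word evaluates to the unit, so each `N n` must contain it; this is inherited from `N
  -- 0`.
  have one_mem : ∀ n x, C.one x ∈ F.N n x x := fun n x => by
    induction n with
    | zero => exact F.zero_diag x ▸ Submodule.mem_span_singleton_self _
    | succ n ih => exact F.mono n x x ih
  refine C.isNiceUnit_of_filtration C.one F.N F.mono F.exhaustive F.zero_diag F.zero_inj
    fun n x y => ?_
  refine exists_graded_retraction (C.internal x y)
    (fun p : ExtWord C (F.N n) (F.S n) x y => (p.mapId GradedQuiver.Label.arrow).sdeg +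
      (p.mapId GradedQuiver.Label.arrow).length)
    (fun p => p.eval C (F.N n) (F.S n)) (fun p => p.evalKill C (F.N n) (F.S n))
    (fun p => C.compSeq_mem _) (fun p => p.evalKill_mem_gr C (F.N n) (F.S n))
    (fun p => p.evalKill_mem C (F.N n) (F.S n) (one_mem n) (F.comp_closed n))
    (F.free n x y).1 (fun e he => ?_) (F.graded n x y) (fun k f hf => ?_)
  -- The kernel is the linear span of relations that already carry their context `a`, `c`, so
  -- checking these generators suffices.
  · have he' := (F.free n x y).2.le (LinearMap.mem_ker.2 he)
    rw [← LinearMap.mem_ker]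
    exact Submodule.span_le.2 (fun _ h => LinearMap.mem_ker.2 h.evalKill_eq_zero) he'
  -- `compSeq` starts from the unit, so a one-letter word evaluates to `1 · f`.
  · exact ⟨CSeq.single (.old ⟨⟨k, f, hf.2⟩, hf.1⟩), C.one_comp f, C.one_comp f⟩

end DifferentialGraded

end AInfty

theorem mainTheorem10 (R : Type w) [CommRing R] :
    (∀ (A : AInfty.SUAInfCat.{u, v} R) (Asf : AInfty.SemiFreeResolution.{u, v, w, u', v'} A),
      Asf.cat.HasNiceUnit) ∧
    (∀ (A : AInfty.DGCat.{u, v} R) (Asf : AInfty.SemiFreeDGResolution.{u, v, w, u', v'} A),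
      Asf.cat.HasNiceUnit) :=
  ⟨fun _ Asf => Asf.semiFree.hasNiceUnit, fun _ Asf => Asf.semiFree.hasNiceUnit⟩
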